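/- Let $\Lambda$ be a finite alphabet and let $X\subset\Lambda^{\mathbb Z}$ (resp. $X\subset\Lambda^{\mathbb N_0}$) be a two-sided (resp. one-sided) subshift, that is, a closed set invariant under the action of $\mathbb Z$ (resp. $\mathbb N_0$) generated by the shift $(\sigma x)(i)=x(i+1)$. Let $\mathcal B^*(X)$ be the set of all blocks (finite words of positive length) occurring in elements of $X$, and let $\mathcal M(X)$ be the set of Borel probability measures on $X$. For blocks $B\in\Lambda^k$, $C\in\Lambda^l$ let $$\mathrm{Fr}_B(C)=\tfrac1k\,\bigl|\{i\in[0,k-l]:\ B|_{[i,i+l)}=C\}\bigr|$$ ($=0$ if $l>k$). For $p\in\mathcal B^*(X)\cup\mathcal M(X)$ put $p(C)=\mathrm{Fr}_B(C)$ if $p$ is a block $B$, and $p(C)=\mu(\{x\in X: x|_{[0,l)}=C\})$ if $p$ is a measure $\mu$. Equip $\mathcal B^*(X)\cup\mathcal M(X)$ with the topology of the (pseudo)metric $$d^*(p,q)=\sum_{l\ge1}2^{-l}\sum_{C\in\Lambda^l}|p(C)-q(C)|.$$ Let $\mathcal U\subset\mathcal B^*(X)\cup\mathcal M(X)$ be an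 open set containing all ergodic shift-invariant measures on $X$; a block $B\in\mathcal B^*(X)$ is called $\mathcal U$-ergodic if $B\in\mathcal U$. For every $m\in\mathbb N$ and every $\varepsilon>0$ there exists $n\ge m$ such that every $x\in X$ has a representation as an infinite concatenation of finite blocks $$x=\dots B_{-2}A_{-2}B_{-1}A_{-1}\,A_1B_1A_2B_2\dots\qquad(\text{resp. } x=A_1B_1A_2B_2\dots),$$ where $A_1$ begins at the coordinate $0$, all blocks $B_j$ are $\mathcal U$-ergodic and have lengths between $m$ and $n$, some of the blocks $A_j$ may be empty, and the set $M$ of coordinates covered by the blocks $A_j$ has upper Banach density $$\inf_{N\ge1}\ \sup_{i}\ \frac{|M\cap[i,i+N)|}{N}<\varepsilon,$$ where $i$ ranges over $\mathbb Z$ (resp. $\mathbb N_0$). -/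

import Mathlib

open SymbolicDynamics.FullShift

/-- A finite block `B = (B(0), …, B(k-1))` over the alphabet `Λ`; the length `k` may be zero. -/
structure Block (Λ : Type*) where
  /-- The length `|B|`. -/
  length : ℕ
  /-- The letters `B(0), …, B(k-1)`. -/
  letter : Fin length → Λ

namespace Block

variable {Λ : Type*}

/-- `C` occurs in the block `B` at the position `i`: `B|_{[i, i + |C|)} = C`. -/
def OccursInBlockAt (C B : Block Λ) (i : ℕ) : Prop :=
  ∃ h : i + C.length ≤ B.length, ∀ j : Fin C.length,
    B.letter ⟨i + j, lt_of_lt_of_le (Nat.add_lt_add_left j.isLt i) h⟩ = C.letter j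

open Classical in
/-- The frequency `Fr_B(C) = |{i ∈ [0, |B| - |C|] : B|_{[i, i + |C|)} = C}| / |B|` of occurrences
of `C` in `B`, which is `0` if `|C| > |B|`. -/
noncomputable def freq (B C : Block Λ) : ℝ :=
  (((Finset.range (B.length + 1)).filter (fun i => C.OccursInBlockAt B i)).card : ℝ) / B.length

/-- `C` occurs in `x` at the position `i`: `x|_{[i, i + |C|)} = C`. The index set `I` is meant to
be `ℤ` or `ℕ`. -/
def OccursAt {I : Type*} [AddMonoidWithOne I] (C : Block Λ) (x : I → Λ) (i : I) : Prop :=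
  ∀ j : Fin C.length, x (i + ((j : ℕ) : I)) = C.letter j

end Block

section Space

variable {Λ : Type*} [TopologicalSpace Λ] {I : Type*} [AddMonoidWithOne I]

/-- The set `B*(X)` of all (nonempty) blocks occurring in the elements of `X`. -/
def language (X : Subshift Λ I) : Set (Block Λ) :=
  {B | 0 < B.length ∧ ∃ x ∈ X.carrier, ∃ i : I, B.OccursAt x i}

/-- The shift `σ : X → X`, `(σ x)(i) = x(i + 1)`. -/
def shiftOn (X : Subshift Λ I) : X.carrier → X.carrier :=
  (X.mapsTo 1).restrict (shift (1 : I)) X.carrier X.carrier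

/-- The cylinder `[C] = {x ∈ X : x|_{[0, |C|)} = C}`. -/
def cyl (X : Subshift Λ I) (C : Block Λ) : Set X.carrier :=
  {x | C.OccursAt (x : I → Λ) 0}

/-- The combined space `B*(X) ∪ M(X)` of the blocks occurring in `X` and of the Borel probability
measures on `X`. -/
inductive BlockMeasureSpace [MeasurableSpace Λ] (X : Subshift Λ I) where
  /-- A block occurring in `X`. -/
  | block (B : language X) : BlockMeasureSpace X
  /-- A Borel probability measure on `X`. -/
  | meas (μ : MeasureTheory.ProbabilityMeasure X.carrier) : BlockMeasureSpace X

namespace BlockMeasureSpace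

variable [MeasurableSpace Λ] {X : Subshift Λ I}

/-- The value ascribed to the block `C`: `Fr_B(C)` for a block `B`, and `μ([C])` for a
measure `μ`. -/
noncomputable def value : BlockMeasureSpace X → Block Λ → ℝ
  | block B, C => (B : Block Λ).freq C
  | meas μ, C => (μ : MeasureTheory.Measure X.carrier).real (cyl X C)

/-- `∑_{C ∈ Λ^l} |value p C - value q C|`. -/
noncomputable def levelDist [Fintype Λ] (l : ℕ) (p q : BlockMeasureSpace X) : ℝ :=
  ∑ c : Fin l → Λ, |p.value ⟨l, c⟩ - q.value ⟨l, c⟩|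

/-- The distance `d*(p, q) = ∑_{l ≥ 1} 2^{-l} ∑_{C ∈ Λ^l} |value p C - value q C|` between blocks
and measures. -/
noncomputable def dStar [Fintype Λ] (p q : BlockMeasureSpace X) : ℝ :=
  ∑' l : ℕ, (1 / 2 : ℝ) ^ (l + 1) * levelDist (l + 1) p q

theorem value_nonneg (p : BlockMeasureSpace X) (C : Block Λ) : 0 ≤ p.value C := by
  cases p with
  | block B => exact div_nonneg (Nat.cast_nonneg _) (Nat.cast_nonneg _)
  | meas μ => exact MeasureTheory.measureReal_nonneg

theorem sum_value_le_one [Fintype Λ] [DiscreteTopology Λ] [BorelSpace Λ] (p : BlockMeasureSpace X)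
    (l : ℕ) : ∑ c : Fin (l + 1) → Λ, p.value ⟨l + 1, c⟩ ≤ 1 := by
  classical
  cases p with
  | block B =>
    obtain ⟨B, hB, -⟩ := B
    simp only [value, Block.freq]
    rw [← Finset.sum_div, div_le_one (by exact_mod_cast hB), ← Nat.cast_sum,
      ← Finset.card_biUnion, Nat.cast_le]
    · refine (Finset.card_le_card (t := Finset.range B.length) ?_).trans (by simp)
      intro i hi
      simp only [Finset.mem_biUnion, Finset.mem_filter, Finset.mem_range] at hi ⊢
      obtain ⟨c, -, -, h, -⟩ := hi
      simp only at h
      omega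
    · intro c _ c' _ hcc
      rw [Function.onFun, Finset.disjoint_left]
      intro i hi hi'
      simp only [Finset.mem_filter] at hi hi'
      obtain ⟨-, h, hc⟩ := hi
      obtain ⟨-, h', hc'⟩ := hi'
      exact hcc (funext fun j => (hc j).symm.trans (hc' j))
  | meas μ =>
    simp only [value]
    rw [← MeasureTheory.measureReal_biUnion_finset]
    · exact MeasureTheory.measureReal_le_one
    · intro c _ c' _ hcc
      rw [Function.onFun, Set.disjoint_left]
      intro x hx hx'
      exact hcc (funext fun j => (hx j).symm.trans (hx' j))
    · intro c _
      have : cyl X ⟨l + 1, c⟩ = ⋂ j : Fin (l + 1),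
          (fun x : X.carrier => (x : I → Λ) (0 + ((j : ℕ) : I))) ⁻¹' {c j} := by
        ext x; simp [cyl, Block.OccursAt]
      rw [this]
      exact MeasurableSet.iInter fun j =>
        ((measurable_pi_apply _).comp measurable_subtype_coe) (measurableSet_singleton _)

theorem levelDist_nonneg [Fintype Λ] (l : ℕ) (p q : BlockMeasureSpace X) :
    0 ≤ levelDist l p q := Finset.sum_nonneg fun _ _ => abs_nonneg _

theorem levelDist_le_two [Fintype Λ] [DiscreteTopology Λ] [BorelSpace Λ] (l : ℕ)
    (p q : BlockMeasureSpace X) : levelDist (l + 1) p q ≤ 2 := by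
  calc levelDist (l + 1) p q
      ≤ ∑ c : Fin (l + 1) → Λ, (p.value ⟨l + 1, c⟩ + q.value ⟨l + 1, c⟩) := by
        refine Finset.sum_le_sum fun c _ => ?_
        have h1 := p.value_nonneg ⟨l + 1, c⟩
        have h2 := q.value_nonneg ⟨l + 1, c⟩
        rw [abs_le]; constructor <;> linarith
    _ ≤ 2 := by
        rw [Finset.sum_add_distrib]
        linarith [p.sum_value_le_one l, q.sum_value_le_one l]

theorem summable_dStar [Fintype Λ] [DiscreteTopology Λ] [BorelSpace Λ]
    (p q : BlockMeasureSpace X) :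
    Summable fun l : ℕ => (1 / 2 : ℝ) ^ (l + 1) * levelDist (l + 1) p q := by
  refine Summable.of_nonneg_of_le (fun l => mul_nonneg (by positivity) (levelDist_nonneg _ _ _))
    (fun l => ?_) (summable_geometric_two)
  have := levelDist_le_two l p q
  have h : (0 : ℝ) ≤ (1 / 2) ^ l := by positivity
  rw [pow_succ]; nlinarith

/-- The topology of `B*(X) ∪ M(X)` is that of the distance `d*`. -/
noncomputable instance [Fintype Λ] [DiscreteTopology Λ] [BorelSpace Λ] :
    PseudoMetricSpace (BlockMeasureSpace X) where
  dist := dStar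
  dist_self p := by simp [dStar, levelDist]
  dist_comm p q := by simp [dStar, levelDist, abs_sub_comm]
  dist_triangle p q r := by
    unfold dStar
    rw [← (summable_dStar p q).tsum_add (summable_dStar q r)]
    refine (summable_dStar p r).tsum_le_tsum (fun l => ?_)
      ((summable_dStar p q).add (summable_dStar q r))
    rw [← mul_add, levelDist, levelDist, levelDist, ← Finset.sum_add_distrib]
    exact mul_le_mul_of_nonneg_left
      (Finset.sum_le_sum fun c _ => abs_sub_le _ _ _) (by positivity)

/-- `U` contains all ergodic (in particular, shift-invariant) measures on `X`. -/
def ContainsErgodic (U : Set (BlockMeasureSpace X)) : Prop :=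
  ∀ μ : MeasureTheory.ProbabilityMeasure X.carrier,
    Ergodic (shiftOn X) (μ : MeasureTheory.Measure X.carrier) → meas μ ∈ U

/-- `B` is a `U`-ergodic block: `B ∈ U` (in particular, `B` is nonempty and occurs in `X`). -/
def IsErgodicBlock (U : Set (BlockMeasureSpace X)) (B : Block Λ) : Prop :=
  ∃ h : B ∈ language X, block ⟨B, h⟩ ∈ U

end BlockMeasureSpace

end Space

/-- The upper Banach density `inf_{N ≥ 1} sup_i |S ∩ [i, i + N)| / N` of a set `S` contained
in `I = ℤ` or `I = ℕ`. -/
noncomputable def upperBanachDensity {I : Type*} [AddMonoidWithOne I] [Preorder I] (S : Set I) :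
    ℝ :=
  ⨅ N : ℕ+, ⨆ i : I, ((S ∩ Set.Ico i (i + ((N : ℕ) : I))).ncard : ℝ) / (N : ℕ)

section Concatenation

variable {Λ : Type*}

/-- The total length of the first `j` pairs of blocks `A 0, B 0, A 1, B 1, …`. -/
def totalLength (A B : ℕ → Block Λ) (j : ℕ) : ℕ :=
  ∑ i ∈ Finset.range j, ((A i).length + (B i).length)

/-- `x ∈ Λ^ℕ` is the infinite concatenation `A 0, B 0, A 1, B 1, …`. -/
def IsConcatenation (x : ℕ → Λ) (A B : ℕ → Block Λ) : Prop :=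
  (∀ i : ℕ, ∃ j, i < totalLength A B j) ∧
  ∀ j, (A j).OccursAt x (totalLength A B j) ∧
    (B j).OccursAt x (totalLength A B j + (A j).length)

/-- The coordinates covered by the blocks `A j` in the concatenation `A 0, B 0, A 1, B 1, …`. -/
def coveredCoords (A B : ℕ → Block Λ) : Set ℕ :=
  ⋃ j, Set.Ico (totalLength A B j) (totalLength A B j + (A j).length)

/-- `x ∈ Λ^ℤ` is the bi-infinite concatenation `…, B' 1, A' 1, B' 0, A' 0, A 0, B 0, A 1, B 1, …`,
in which `A 0` begins at the coordinate `0`, and `A' 0` ends just before it. -/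
def IsBiConcatenation (x : ℤ → Λ) (A B A' B' : ℕ → Block Λ) : Prop :=
  (∀ i : ℕ, ∃ j, i < totalLength A B j) ∧
  (∀ j, (A j).OccursAt x (totalLength A B j) ∧
    (B j).OccursAt x (totalLength A B j + (A j).length)) ∧
  (∀ i : ℕ, ∃ j, i < totalLength A' B' j) ∧
  (∀ j, (A' j).OccursAt x (-(totalLength A' B' j : ℤ) - (A' j).length) ∧
    (B' j).OccursAt x (-(totalLength A' B' j : ℤ) - (A' j).length - (B' j).length))

/-- The coordinates covered by the blocks `A j` and `A' j` in the bi-infinite concatenation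
`…, B' 1, A' 1, B' 0, A' 0, A 0, B 0, A 1, B 1, …`. -/
def biCoveredCoords (A B A' B' : ℕ → Block Λ) : Set ℤ :=
  (⋃ j, Set.Ico (totalLength A B j : ℤ) (totalLength A B j + (A j).length)) ∪
  (⋃ j, Set.Ico (-(totalLength A' B' j : ℤ) - (A' j).length) (-(totalLength A' B' j : ℤ)))

end Concatenation

/-! Call a coordinate `t` of `x` bad if no ergodic block of length in `[m, n]` starts at `t` (for
`ℤ`: or if none ends at `t`). Cut `x` greedily from `0`, skipping letters until an ergodic block
starts and then taking it, and on the negative half-line do the same leftwards. Every skipped letter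
is bad, so it suffices that, for a suitable `n`, bad coordinates have frequency below `ε/2` in all
windows of one length `N`, uniformly in `x`.

For an ergodic `μ`, long initial blocks are ergodic with `μ`-probability tending to 1: `d*` is
controlled by finitely many cylinders, and the mean ergodic theorem gives convergence in measure of
their frequencies (`ContainsErgodic.tendsto_measure_not_isErgodicBlock`). So the clopen sets `F n`
of points with bad coordinate `0` decrease in `n` to a set that is null for every ergodic measure.

Uniformity is by compactness (`exists_forall_card_orbit_lt`). Otherwise a limit of empirical
measures is an invariant measure giving `⋂ F n` mass at least `ε/2` (capped at 1), and by
`exists_ergodic_measure_ge` some ergodic measure does too, a contradiction. -/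

/-! ### Invariant measures: passing from an invariant to an ergodic measure -/

section InvariantMeasures

open MeasureTheory Filter Topology Set
open scoped ENNReal

variable {Y : Type*} [TopologicalSpace Y] [MeasurableSpace Y] [BorelSpace Y]
  [HasOuterApproxClosed Y]

theorem isClosed_setOf_le_measure {E : Set Y} (hE : IsClosed E) (c : ℝ≥0∞) :
    IsClosed {μ : ProbabilityMeasure Y | c ≤ (μ : Measure Y) E} := by
  refine isClosed_of_closure_subset fun μ hμ => ?_
  rw [mem_closure_iff_nhdsWithin_neBot] at hμ
  have hlim : Tendsto id (𝓝[{μ : ProbabilityMeasure Y | c ≤ (μ : Measure Y) E}] μ) (𝓝 μ) :=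
    tendsto_id.mono_left nhdsWithin_le_nhds
  refine le_trans ?_ (ProbabilityMeasure.limsup_measure_closed_le_of_tendsto hlim hE)
  refine le_limsup_of_frequently_le (Eventually.frequently ?_)
  exact eventually_mem_nhdsWithin

theorem isClosed_setOf_measurePreserving {T : Y → Y} (hT : Continuous T) :
    IsClosed {μ : ProbabilityMeasure Y | MeasurePreserving T (μ : Measure Y) μ} := by
  have h : {μ : ProbabilityMeasure Y | MeasurePreserving T (μ : Measure Y) μ} =
      {μ | μ.map hT.measurable.aemeasurable = μ} := by
    ext μ
    constructor
    · intro h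
      exact Subtype.ext h.map_eq
    · intro h
      exact ⟨hT.measurable, congrArg Subtype.val h⟩
  rw [h]
  exact isClosed_eq (ProbabilityMeasure.continuous_map hT) continuous_id

/-- `ν ↦ ν E` is affine and upper semicontinuous on the compact convex set of invariant measures, so
its maximizers form a nonempty compact face. An extreme point of that face is extreme among all
invariant probability measures, hence ergodic. -/
theorem exists_ergodic_measure_ge [CompactSpace Y] [T2Space Y] {T : Y → Y} (hT : Continuous T)
    {E : Set Y} (hE : IsClosed E) (μ : ProbabilityMeasure Y)
    (hμ : MeasurePreserving T (μ : Measure Y) μ) :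
    ∃ ν : ProbabilityMeasure Y, Ergodic T (ν : Measure Y) ∧
      (μ : Measure Y) E ≤ (ν : Measure Y) E := by
  set K : Set (ProbabilityMeasure Y) := {μ | MeasurePreserving T (μ : Measure Y) μ}
  have hK : IsCompact K := (isClosed_setOf_measurePreserving hT).isCompact
  have husc : UpperSemicontinuous fun μ : ProbabilityMeasure Y => (μ : Measure Y) E :=
    upperSemicontinuous_iff_isClosed_preimage.2 fun c => isClosed_setOf_le_measure hE c
  obtain ⟨μ₀, hμ₀K, hμ₀⟩ := (husc.upperSemicontinuousOn K).exists_isMaxOn ⟨μ, hμ⟩ hK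
  have hmax : ∀ ν ∈ K, (ν : Measure Y) E ≤ (μ₀ : Measure Y) E := fun ν hν => hμ₀ hν
  set K' : Set (ProbabilityMeasure Y) := K ∩ {ν | (μ₀ : Measure Y) E ≤ (ν : Measure Y) E}
  have hK' : IsCompact K' := hK.inter_right (isClosed_setOf_le_measure hE _)
  -- Existence of extreme points needs a locally convex vector space; `Φ` embeds the probability
  -- measures in one.
  set Φ : ProbabilityMeasure Y → C(Y, ℝ) → ℝ := fun ν f => ∫ y, f y ∂(ν : Measure Y)
  have hΦ : Continuous Φ := continuous_pi fun f =>
    ProbabilityMeasure.continuous_integral_continuousMap f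
  have hΦinj : ∀ ν₁ ν₂ : ProbabilityMeasure Y, Φ ν₁ = Φ ν₂ → ν₁ = ν₂ := by
    intro ν₁ ν₂ h
    refine Subtype.ext (ext_of_forall_integral_eq_of_IsFiniteMeasure (μ := (ν₁ : Measure Y))
      (ν := (ν₂ : Measure Y)) fun f => ?_)
    exact congrFun h f.toContinuousMap
  obtain ⟨-, ⟨ν, hνK', rfl⟩, hext⟩ := (hK'.image hΦ).extremePoints_nonempty
    ⟨_, mem_image_of_mem Φ (⟨hμ₀K, le_refl ((μ₀ : Measure Y) E)⟩ : μ₀ ∈ K')⟩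
  refine ⟨ν, Ergodic.of_mem_extremePoints ⟨⟨hνK'.1, inferInstance⟩, ?_⟩,
    (hmax μ hμ).trans hνK'.2⟩
  rintro ν₁ ⟨hν₁, hp₁⟩ ν₂ ⟨hν₂, hp₂⟩ ⟨a, b, ha, hb, hab, hν⟩
  have ha' : a ≠ ∞ := fun h => by simp [h] at hab
  have hb' : b ≠ ∞ := fun h => by simp [h] at hab
  have hνE : a * ν₁ E + b * ν₂ E = (ν : Measure Y) E := by rw [← hν]; simp
  have hm₁ : ν₁ E ≤ (μ₀ : Measure Y) E := hmax ⟨ν₁, hp₁⟩ hν₁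
  have hm₂ : ν₂ E ≤ (μ₀ : Measure Y) E := hmax ⟨ν₂, hp₂⟩ hν₂
  -- The face property: a convex combination with positive weights attains the maximum only if both
  -- components do.
  have hm : a * (μ₀ : Measure Y) E + b * (μ₀ : Measure Y) E ≤ a * ν₁ E + b * ν₂ E := by
    rw [← add_mul, hab, one_mul, hνE]; exact hνK'.2
  have key : ∀ {c d u v w : ℝ≥0∞}, c ≠ 0 → c ≠ ∞ → d ≠ ∞ → w ≠ ∞ → u ≤ w → v ≤ w →
      c * w + d * w ≤ c * u + d * v → w ≤ u := by
    intro c d u v w hc hc' hd hw hu hv h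
    have h1 : c * w + d * w ≤ c * u + d * w := h.trans (by gcongr)
    have h2 := (ENNReal.add_le_add_iff_right (ENNReal.mul_ne_top hd hw)).1 h1
    exact (ENNReal.mul_le_mul_iff_right hc hc').1 h2
  have hw : (μ₀ : Measure Y) E ≠ ∞ := measure_ne_top _ _
  have h₁ : (⟨ν₁, hp₁⟩ : ProbabilityMeasure Y) ∈ K' :=
    ⟨hν₁, key ha.ne' ha' hb' hw hm₁ hm₂ hm⟩
  have h₂ : (⟨ν₂, hp₂⟩ : ProbabilityMeasure Y) ∈ K' :=
    ⟨hν₂, key hb.ne' hb' ha' hw hm₂ hm₁ (by rw [add_comm, add_comm (b * _)]; exact hm)⟩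
  have := hext (mem_image_of_mem Φ h₁) (mem_image_of_mem Φ h₂) ⟨a.toReal, b.toReal,
    ENNReal.toReal_pos ha.ne' ha', ENNReal.toReal_pos hb.ne' hb', by
      rw [← ENNReal.toReal_add ha' hb', hab, ENNReal.toReal_one], by
      ext f
      have hi : ∀ ρ : Measure Y, IsProbabilityMeasure ρ → Integrable f ρ := fun ρ _ =>
        (BoundedContinuousFunction.mkOfCompact f).integrable ρ
      change a.toReal * ∫ y, f y ∂ν₁ + b.toReal * ∫ y, f y ∂ν₂ = ∫ y, f y ∂(ν : Measure Y)
      rw [← hν, integral_add_measure ((hi _ hp₁).smul_measure ha') ((hi _ hp₂).smul_measure hb'),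
        integral_smul_measure, integral_smul_measure]
      rfl⟩
  exact congrArg Subtype.val (hΦinj _ _ this)

end InvariantMeasures

/-! ### Empirical measures and uniform frequencies along orbits -/

section EmpiricalMeasures

open MeasureTheory Filter Topology Set
open scoped ENNReal

variable {Y : Type*} [MeasurableSpace Y]

/-- The uniform probability measure on the orbit segment `y, T y, …, T ^ n y`. -/
noncomputable def empiricalMeasure (T : Y → Y) (n : ℕ) (y : Y) : ProbabilityMeasure Y :=
  ⟨((n + 1 : ℕ) : ℝ≥0∞)⁻¹ • ∑ j ∈ Finset.range (n + 1), Measure.dirac (T^[j] y), ⟨by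
    simp only [Measure.smul_apply, Measure.finsetSum_apply, measure_univ, Finset.sum_const,
      Finset.card_range, smul_eq_mul, nsmul_eq_mul, mul_one]
    exact ENNReal.inv_mul_cancel (by simp) (by simp)⟩⟩

theorem integral_empiricalMeasure [TopologicalSpace Y] [OpensMeasurableSpace Y] (T : Y → Y)
    (n : ℕ) (y : Y) (f : BoundedContinuousFunction Y ℝ) :
    ∫ z, f z ∂(empiricalMeasure T n y : Measure Y) =
      (n + 1 : ℝ)⁻¹ * ∑ j ∈ Finset.range (n + 1), f (T^[j] y) := by
  change ∫ z, f z ∂(((n + 1 : ℕ) : ℝ≥0∞)⁻¹ • ∑ j ∈ Finset.range (n + 1),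
    Measure.dirac (T^[j] y)) = _
  rw [integral_smul_measure, integral_finsetSum_measure fun j _ => f.integrable _]
  congr 1
  · rw [ENNReal.toReal_inv, ENNReal.toReal_natCast]; push_cast; rfl
  · exact Finset.sum_congr rfl fun j _ =>
      integral_dirac' _ _ f.continuous.measurable.stronglyMeasurable

open Classical in
theorem empiricalMeasure_real_apply (T : Y → Y) (n : ℕ) (y : Y) {F : Set Y}
    (hF : MeasurableSet F) :
    (empiricalMeasure T n y : Measure Y).real F =
      (((Finset.range (n + 1)).filter fun j => T^[j] y ∈ F).card : ℝ) / (n + 1 : ℕ) := by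
  change (((n + 1 : ℕ) : ℝ≥0∞)⁻¹ • ∑ j ∈ Finset.range (n + 1),
    Measure.dirac (T^[j] y) : Measure Y).real F = _
  rw [measureReal_ennreal_smul_apply, ENNReal.toReal_inv, ENNReal.toReal_natCast, div_eq_inv_mul]
  congr 1
  rw [measureReal_def, Measure.finsetSum_apply, Finset.card_filter]
  rw [ENNReal.toReal_sum fun j _ => measure_ne_top _ _, Nat.cast_sum]
  refine Finset.sum_congr rfl fun j _ => ?_
  rw [Measure.dirac_apply' _ hF]
  by_cases h : T^[j] y ∈ F <;> simp [h]

/-- The Krylov–Bogolyubov argument: the orbit averages of `f ∘ T` and `f` telescope to a difference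
of at most `2‖f‖ / (n + 1)`. -/
theorem measurePreserving_of_tendsto_empiricalMeasure [TopologicalSpace Y] [BorelSpace Y]
    [HasOuterApproxClosed Y] {T : Y → Y} (hT : Continuous T) {l : Filter ℕ} [l.NeBot]
    (hl : l ≤ atTop) {y : ℕ → Y} {μ : ProbabilityMeasure Y}
    (hμ : Tendsto (fun n => empiricalMeasure T n (y n)) l (𝓝 μ)) :
    MeasurePreserving T (μ : Measure Y) μ := by
  refine ⟨hT.measurable, ?_⟩
  have : IsProbabilityMeasure ((μ : Measure Y).map T) :=
    Measure.isProbabilityMeasure_map hT.measurable.aemeasurable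
  refine ext_of_forall_integral_eq_of_IsFiniteMeasure fun f => ?_
  rw [integral_map hT.measurable.aemeasurable
    f.continuous.measurable.stronglyMeasurable.aestronglyMeasurable]
  have h := ProbabilityMeasure.tendsto_iff_forall_integral_tendsto.1 hμ
  have h1 := h f
  have h2 := h (f.compContinuous ⟨T, hT⟩)
  have h3 : Tendsto (fun n : ℕ => (n + 1 : ℝ)⁻¹ * (2 * ‖f‖)) l (𝓝 0) := by
    have := (tendsto_one_div_add_atTop_nhds_zero_nat (𝕜 := ℝ)).mul_const (2 * ‖f‖)
    simp only [one_div, zero_mul] at this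
    exact this.mono_left hl
  have h4 : Tendsto (fun n => ∫ z, f.compContinuous ⟨T, hT⟩ z
      ∂(empiricalMeasure T n (y n) : Measure Y) -
      ∫ z, f z ∂(empiricalMeasure T n (y n) : Measure Y)) l (𝓝 0) := by
    refine squeeze_zero_norm (fun n => ?_) h3
    rw [integral_empiricalMeasure, integral_empiricalMeasure, ← mul_sub, ← Finset.sum_sub_distrib,
      norm_mul, Real.norm_of_nonneg (by positivity : (0 : ℝ) ≤ (n + 1 : ℝ)⁻¹)]
    refine mul_le_mul_of_nonneg_left ?_ (by positivity)
    have : ∀ j ∈ Finset.range (n + 1), f.compContinuous ⟨T, hT⟩ (T^[j] (y n)) - f (T^[j] (y n)) =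
        f (T^[j + 1] (y n)) - f (T^[j] (y n)) := fun j _ => by
      rw [Function.iterate_succ_apply']; rfl
    rw [Finset.sum_congr rfl this, Finset.sum_range_sub fun j => f (T^[j] (y n)), two_mul]
    exact (norm_sub_le _ _).trans (add_le_add (f.norm_coe_le_norm _) (f.norm_coe_le_norm _))
  exact sub_eq_zero.1 (tendsto_nhds_unique (h2.sub h1) h4)

open Classical in
/-- If a decreasing sequence of closed sets has vanishing measure for every ergodic measure, then
orbits visit far members of the sequence with uniformly small frequency. -/
theorem exists_forall_card_orbit_lt [TopologicalSpace Y] [BorelSpace Y] [HasOuterApproxClosed Y]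
    [CompactSpace Y] [T2Space Y] {T : Y → Y} (hT : Continuous T) {F : ℕ → Set Y}
    (hF : Antitone F) (hFc : ∀ n, IsClosed (F n))
    (hFerg : ∀ μ : ProbabilityMeasure Y, Ergodic T (μ : Measure Y) →
      Tendsto (fun n => (μ : Measure Y) (F n)) atTop (𝓝 0))
    {ε : ℝ} (hε : 0 < ε) :
    ∃ n N : ℕ, 0 < N ∧ ∀ y, (((Finset.range N).filter fun j => T^[j] y ∈ F n).card : ℝ) < ε * N := by
  by_contra! hcon
  choose y hy using fun n => hcon n (n + 1) n.succ_pos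
  -- A limit along a free ultrafilter replaces the extraction of a convergent subsequence.
  set 𝒰 : Ultrafilter ℕ := hyperfilter ℕ
  have h𝒰 : (𝒰 : Filter ℕ) ≤ atTop := Nat.hyperfilter_le_atTop
  obtain ⟨μ, -, hμ⟩ := isCompact_univ.ultrafilter_le_nhds
    (𝒰.map fun n => empiricalMeasure T n (y n)) (by simp)
  have hμ : Tendsto (fun n => empiricalMeasure T n (y n)) 𝒰 (𝓝 μ) := hμ
  have hinv := measurePreserving_of_tendsto_empiricalMeasure hT h𝒰 hμ
  -- For `n ≥ k` the `n`-th empirical measure gives `F k ⊇ F n` mass at least `ε`; this survives in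
  -- the limit as `F k` is closed.
  have hge : ∀ k, ENNReal.ofReal ε ≤ (μ : Measure Y) (F k) := by
    intro k
    refine (isClosed_setOf_le_measure (hFc k) (ENNReal.ofReal ε)).mem_of_tendsto hμ ?_
    filter_upwards [h𝒰 (eventually_ge_atTop k)] with n hn
    refine le_trans ?_ (measure_mono (hF hn))
    rw [← ofReal_measureReal]
    refine ENNReal.ofReal_le_ofReal ?_
    rw [empiricalMeasure_real_apply _ _ _ (hFc n).measurableSet, le_div_iff₀ (by positivity)]
    exact hy n
  have hinter : ENNReal.ofReal ε ≤ (μ : Measure Y) (⋂ k, F k) := by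
    rw [hF.measure_iInter (fun n => (hFc n).measurableSet.nullMeasurableSet)
      ⟨0, measure_ne_top _ _⟩]
    exact le_iInf hge
  obtain ⟨ν, hν, hμν⟩ := exists_ergodic_measure_ge hT (isClosed_iInter hFc) μ hinv
  have : ENNReal.ofReal ε ≤ 0 := ge_of_tendsto' (hFerg ν hν) fun n =>
    hinter.trans (hμν.trans (measure_mono (iInter_subset _ _)))
  simp only [nonpos_iff_eq_zero, ENNReal.ofReal_eq_zero] at this
  linarith

end EmpiricalMeasures

/-! ### The mean ergodic theorem and convergence in measure of visit frequencies -/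

section MeanErgodic

open MeasureTheory Filter Topology Set
open scoped ENNReal InnerProductSpace

variable {Y : Type*} [MeasurableSpace Y] {μ : Measure Y} {T : Y → Y}

/-- The composition with a measure preserving map, as a contraction of `L²`. -/
noncomputable def koopman (hT : MeasurePreserving T μ μ) : Lp ℝ 2 μ →L[ℝ] Lp ℝ 2 μ :=
  (Lp.compMeasurePreservingₗᵢ ℝ T hT).toContinuousLinearMap

theorem koopman_coe (hT : MeasurePreserving T μ μ) :
    ⇑(koopman hT) = Lp.compMeasurePreserving T hT := rfl

theorem norm_koopman_le (hT : MeasurePreserving T μ μ) : ‖koopman hT‖ ≤ 1 :=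
  ContinuousLinearMap.opNorm_le_bound _ zero_le_one fun f => by
    rw [one_mul, koopman_coe, Lp.norm_compMeasurePreserving f hT]

/-- By ergodicity a fixed vector of the Koopman operator is a.e. constant; pairing with the fixed
vector `1` identifies the constant. -/
theorem Ergodic.orthogonalProjectionOnto_indicatorConstLp [IsProbabilityMeasure μ]
    (hT : Ergodic T μ) {D : Set Y} (hD : MeasurableSet D) :
    (((koopman hT.toMeasurePreserving).eqLocus
      (1 : Lp ℝ 2 μ →L[ℝ] Lp ℝ 2 μ)).orthogonalProjectionOnto
        (indicatorConstLp 2 hD (measure_ne_top μ D) (1 : ℝ)) : Lp ℝ 2 μ) =ᵐ[μ]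
      fun _ => μ.real D := by
  set S := (koopman hT.toMeasurePreserving).eqLocus (1 : Lp ℝ 2 μ →L[ℝ] Lp ℝ 2 μ)
  set f : Lp ℝ 2 μ := indicatorConstLp 2 hD (measure_ne_top μ D) (1 : ℝ) with hf
  have heS : indicatorConstLp 2 MeasurableSet.univ (measure_ne_top μ univ) (1 : ℝ) ∈ S :=
    Lp.indicatorConstLp_compMeasurePreserving MeasurableSet.univ (measure_ne_top μ univ) (1 : ℝ)
      hT.toMeasurePreserving
  have h1 := Submodule.inner_orthogonalProjectionOnto_eq_of_mem_left (⟨_, heS⟩ : S) f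
  rw [Submodule.coe_inner] at h1
  generalize S.orthogonalProjectionOnto f = g at h1
  obtain ⟨g, hg⟩ := g
  have hgfix : Lp.compMeasurePreserving T hT.toMeasurePreserving g = g := hg
  obtain ⟨c, hc⟩ := hT.ae_eq_const_of_ae_eq_comp_ae (Lp.aestronglyMeasurable g)
    (by
      have h := Lp.coeFn_compMeasurePreserving g hT.toMeasurePreserving
      rw [hgfix] at h
      exact h.symm)
  have hcD : c = μ.real D := by
    rw [hf, L2.real_inner_indicatorConstLp_one_indicatorConstLp_one,
      L2.inner_indicatorConstLp_one, Measure.restrict_univ, integral_congr_ae hc,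
      univ_inter] at h1
    simpa using h1
  rw [← hcD]
  exact hc

open Classical in
theorem birkhoffAverage_koopman_indicatorConstLp [IsFiniteMeasure μ]
    (hT : MeasurePreserving T μ μ) {D : Set Y} (hD : MeasurableSet D) (n : ℕ) :
    (birkhoffAverage ℝ (koopman hT) _root_.id n
      (indicatorConstLp 2 hD (measure_ne_top μ D) (1 : ℝ)) : Lp ℝ 2 μ) =ᵐ[μ]
      fun y => (((Finset.range n).filter fun j => T^[j] y ∈ D).card : ℝ) / n := by
  set f : Lp ℝ 2 μ := indicatorConstLp 2 hD (measure_ne_top μ D) (1 : ℝ)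
  have hterm : ∀ j ∈ Finset.range n, (((koopman hT)^[j] f : Lp ℝ 2 μ) : Y → ℝ) =ᵐ[μ]
      fun y => if T^[j] y ∈ D then 1 else 0 := by
    intro j _
    rw [koopman_coe, Lp.compMeasurePreserving_iterate]
    refine (Lp.coeFn_compMeasurePreserving f (hT.iterate j)).trans ?_
    have h := (hT.iterate j).quasiMeasurePreserving.ae_eq_comp
      (indicatorConstLp_coeFn (p := 2) (hs := hD) (hμs := measure_ne_top μ D) (c := (1 : ℝ)))
    refine h.trans (Eventually.of_forall fun y => ?_)
    simp [indicator_apply]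
  have h := (ae_ball_iff (Finset.range n).countable_toSet).2 hterm
  have hsum := Lp.coeFn_finsetSum (Finset.range n) fun j => (koopman hT)^[j] f
  have hsmul := Lp.coeFn_smul (n : ℝ)⁻¹ (∑ j ∈ Finset.range n, (koopman hT)^[j] f)
  have hdef : birkhoffAverage ℝ (koopman hT) _root_.id n f =
      (n : ℝ)⁻¹ • ∑ j ∈ Finset.range n, (koopman hT)^[j] f := rfl
  rw [hdef]
  filter_upwards [h, hsum, hsmul] with y hy hy1 hy2
  rw [hy2, Pi.smul_apply, hy1, Finset.sum_apply, Finset.sum_congr rfl hy, Finset.card_filter,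
    smul_eq_mul, div_eq_inv_mul]
  push_cast
  rfl

open Classical in
/-- The frequency of visits to a measurable set along an orbit converges in measure to the measure
of the set, if the measure is ergodic. -/
theorem Ergodic.tendsto_measure_abs_card_orbit_sub [IsProbabilityMeasure μ]
    (hT : Ergodic T μ) {D : Set Y} (hD : MeasurableSet D) {η : ℝ} (hη : 0 < η) :
    Tendsto (fun n : ℕ => μ {y | η ≤
      |(((Finset.range n).filter fun j => T^[j] y ∈ D).card : ℝ) / n - μ.real D|}) atTop (𝓝 0) := by
  have hlim := (koopman hT.toMeasurePreserving).tendsto_birkhoffAverage_orthogonalProjection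
    (norm_koopman_le hT.toMeasurePreserving)
    (indicatorConstLp 2 hD (measure_ne_top μ D) (1 : ℝ))
  have h := (tendstoInMeasure_of_tendsto_Lp hlim).congr
    (birkhoffAverage_koopman_indicatorConstLp hT.toMeasurePreserving hD)
    (hT.orthogonalProjectionOnto_indicatorConstLp hD)
  rw [tendstoInMeasure_iff_dist] at h
  exact h η hη

end MeanErgodic

/-! ### Windows of a sequence and their frequencies as orbit visits -/

section Windows

open Filter Topology Set

variable {Λ : Type*} {I : Type*} [AddMonoidWithOne I]

/-- The block `x|_{[i, i + k)}`. -/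
def window (x : I → Λ) (i : I) (k : ℕ) : Block Λ := ⟨k, fun j => x (i + ((j : ℕ) : I))⟩

@[simp] theorem window_length (x : I → Λ) (i : I) (k : ℕ) : (window x i k).length = k := rfl

theorem window_occursAt (x : I → Λ) (i : I) (k : ℕ) : (window x i k).OccursAt x i := fun _ => rfl

theorem window_shift (x : I → Λ) (g i : I) (k : ℕ) :
    window (shift g x) i k = window x (g + i) k := by
  simp [window, add_assoc]

variable [TopologicalSpace Λ] {X : Subshift Λ I}

theorem window_mem_language (x : X.carrier) (i : I) {k : ℕ} (hk : 0 < k) :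
    window (x : I → Λ) i k ∈ language X :=
  ⟨hk, x, x.2, i, window_occursAt _ _ _⟩

theorem coe_iterate_shiftOn (x : X.carrier) (j : ℕ) :
    (((shiftOn X)^[j] x : X.carrier) : I → Λ) = shift (j : I) (x : I → Λ) := by
  induction j with
  | zero => simp
  | succ j ih =>
    rw [Function.iterate_succ_apply', Nat.cast_succ, shift_add, ← ih]
    rfl

theorem continuous_shiftOn : Continuous (shiftOn X) :=
  (continuous_shift (1 : I)).restrict (X.mapsTo 1)

theorem isClopen_setOf_window [Finite Λ] [DiscreteTopology Λ] (P : Block Λ → Prop) (i : I)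
    (k : ℕ) : IsClopen {x : X.carrier | P (window (x : I → Λ) i k)} := by
  have hc : Continuous fun (x : X.carrier) (j : Fin k) => (x : I → Λ) (i + ((j : ℕ) : I)) := by
    exact continuous_pi fun j => (continuous_apply _).comp continuous_subtype_val
  exact (isClopen_discrete {w : Fin k → Λ | P ⟨k, w⟩}).preimage hc

theorem isClopen_cyl [Finite Λ] [DiscreteTopology Λ] (C : Block Λ) : IsClopen (cyl X C) := by
  obtain ⟨k, w⟩ := C
  have h : cyl X ⟨k, w⟩ = {x : X.carrier | window (x : I → Λ) 0 k = ⟨k, w⟩} := by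
    ext x
    simp [cyl, Block.OccursAt, window, funext_iff]
  rw [h]
  exact isClopen_setOf_window (· = ⟨k, w⟩) 0 k

theorem occursInBlockAt_window_iff (x : X.carrier) (C : Block Λ) (i k : ℕ) :
    C.OccursInBlockAt (window (x : I → Λ) 0 k) i ↔
      i + C.length ≤ k ∧ (shiftOn X)^[i] x ∈ cyl X C := by
  simp [Block.OccursInBlockAt, window, cyl, Block.OccursAt, coe_iterate_shiftOn]

open Classical in
-- The two counts differ only at starting positions in the last `C.length` places, where `C` may
-- stick out of the window.
theorem abs_freq_window_sub_le (x : X.carrier) {C : Block Λ} (hC : 0 < C.length) (k : ℕ) :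
    |(window (x : I → Λ) 0 k).freq C -
      (((Finset.range k).filter fun j => (shiftOn X)^[j] x ∈ cyl X C).card : ℝ) / k| ≤
      C.length / k := by
  set s := (Finset.range (k + 1)).filter fun i => C.OccursInBlockAt (window (x : I → Λ) 0 k) i
  set t := (Finset.range k).filter fun j => (shiftOn X)^[j] x ∈ cyl X C
  have hst : s ⊆ t := by
    intro i hi
    simp only [s, t, Finset.mem_filter, Finset.mem_range, occursInBlockAt_window_iff] at hi ⊢
    exact ⟨by omega, hi.2.2⟩
  have hts : t ⊆ s ∪ Finset.Ico (k - C.length) k := by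
    intro i hi
    simp only [s, t, Finset.mem_filter, Finset.mem_range, occursInBlockAt_window_iff,
      Finset.mem_union, Finset.mem_Ico] at hi ⊢
    by_cases h : i + C.length ≤ k
    · exact Or.inl ⟨by omega, h, hi.2⟩
    · exact Or.inr (by omega)
  have h1 : (s.card : ℝ) ≤ t.card := by exact_mod_cast Finset.card_le_card hst
  have h2 : (t.card : ℝ) ≤ s.card + C.length := by
    have h := (Finset.card_le_card hts).trans (Finset.card_union_le _ _)
    rw [Nat.card_Ico] at h
    have : t.card ≤ s.card + C.length := by omega
    exact_mod_cast this
  have hfreq : (window (x : I → Λ) 0 k).freq C = (s.card : ℝ) / k := rfl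
  rw [hfreq, ← sub_div, abs_div, Nat.abs_cast]
  refine div_le_div_of_nonneg_right ?_ (Nat.cast_nonneg _)
  rw [abs_le]
  constructor <;> linarith

end Windows

/-! ### Typical long blocks are ergodic -/

section ErgodicBlocks

open MeasureTheory Filter Topology Set

variable {Λ : Type*} [Fintype Λ] [TopologicalSpace Λ] [DiscreteTopology Λ] [MeasurableSpace Λ]
  [BorelSpace Λ] {I : Type*} [AddMonoidWithOne I] {X : Subshift Λ I}

namespace BlockMeasureSpace

/-- Each level distance is at most 2, so the tail of the series is uniformly small and only blocks
of length at most `L` matter. -/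
theorem exists_forall_dist_lt {δ : ℝ} (hδ : 0 < δ) :
    ∃ (L : ℕ) (η : ℝ), 0 < η ∧ ∀ p q : BlockMeasureSpace X,
      (∀ l < L, ∀ c : Fin (l + 1) → Λ, |p.value ⟨l + 1, c⟩ - q.value ⟨l + 1, c⟩| < η) →
      dist p q < δ := by
  obtain ⟨L, hL⟩ := ((tendsto_sum_nat_add fun l : ℕ => (1 / 2 : ℝ) ^ l).eventually
    (gt_mem_nhds (half_pos hδ))).exists
  set S : ℝ := ∑ l ∈ Finset.range L, (Fintype.card (Fin (l + 1) → Λ) : ℝ)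
  have hS : 0 ≤ S := Finset.sum_nonneg fun _ _ => Nat.cast_nonneg _
  refine ⟨L, δ / 2 / (S + 1), by positivity, fun p q h => ?_⟩
  change dStar p q < δ
  rw [dStar, ← (summable_dStar p q).sum_add_tsum_nat_add L]
  have hhead : ∑ l ∈ Finset.range L, (1 / 2 : ℝ) ^ (l + 1) * levelDist (l + 1) p q ≤ δ / 2 := by
    calc ∑ l ∈ Finset.range L, (1 / 2 : ℝ) ^ (l + 1) * levelDist (l + 1) p q
        ≤ ∑ l ∈ Finset.range L, (Fintype.card (Fin (l + 1) → Λ) : ℝ) * (δ / 2 / (S + 1)) := by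
          refine Finset.sum_le_sum fun l hl => ?_
          have h1 : levelDist (l + 1) p q ≤
              (Fintype.card (Fin (l + 1) → Λ) : ℝ) * (δ / 2 / (S + 1)) := by
            rw [levelDist, ← nsmul_eq_mul]
            exact Finset.sum_le_card_nsmul _ _ _ fun c _ =>
              (h l (Finset.mem_range.1 hl) c).le
          exact (mul_le_of_le_one_left (levelDist_nonneg _ _ _)
            (pow_le_one₀ (by norm_num) (by norm_num))).trans h1
      _ = S / (S + 1) * (δ / 2) := by rw [← Finset.sum_mul]; ring
      _ ≤ δ / 2 := mul_le_of_le_one_left (half_pos hδ).le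
          ((div_le_one (by linarith)).2 (by linarith))
  have htail : ∑' l, (1 / 2 : ℝ) ^ (l + L + 1) * levelDist (l + L + 1) p q ≤
      ∑' l, (1 / 2 : ℝ) ^ (l + L) := by
    refine ((summable_nat_add_iff L).2 (summable_dStar p q)).tsum_le_tsum (fun l => ?_)
      ((summable_nat_add_iff L).2 summable_geometric_two)
    have h1 := levelDist_le_two (l + L) p q
    have h2 : (0 : ℝ) ≤ (1 / 2) ^ (l + L) := by positivity
    rw [pow_succ]
    nlinarith
  linarith

/-- For an ergodic measure, long initial blocks are ergodic with probability close to one. -/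
theorem ContainsErgodic.tendsto_measure_not_isErgodicBlock [Countable I]
    {U : Set (BlockMeasureSpace X)} (hUo : IsOpen U) (hU : ContainsErgodic U)
    {μ : ProbabilityMeasure X.carrier} (hμ : Ergodic (shiftOn X) (μ : Measure X.carrier)) :
    Tendsto (fun k => (μ : Measure X.carrier)
      {x | ¬ IsErgodicBlock U (window (x : I → Λ) 0 k)}) atTop (𝓝 0) := by
  classical
  obtain ⟨δ, hδ, hball⟩ := Metric.isOpen_iff.1 hUo _ (hU μ hμ)
  obtain ⟨L, η, hη, hdist⟩ := exists_forall_dist_lt (X := X) hδ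
  -- Half of `η` is allotted to the deviation of the orbit frequency, half to the boundary error `L
  -- / k` of the window.
  set D : (Σ l : Fin L, Fin ((l : ℕ) + 1) → Λ) → ℕ → Set X.carrier := fun a k => {x | η / 2 ≤
    |(((Finset.range k).filter fun j =>
      (shiftOn X)^[j] x ∈ cyl X ⟨(a.1 : ℕ) + 1, a.2⟩).card : ℝ) / k -
      (μ : Measure X.carrier).real (cyl X ⟨(a.1 : ℕ) + 1, a.2⟩)|}
  have hD : Tendsto (fun k => ∑ a, (μ : Measure X.carrier) (D a k)) atTop (𝓝 0) := by
    rw [← Finset.sum_const_zero (s := Finset.univ)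
      (ι := Σ l : Fin L, Fin ((l : ℕ) + 1) → Λ)]
    exact tendsto_finsetSum _ fun a _ =>
      hμ.tendsto_measure_abs_card_orbit_sub (isClopen_cyl _).1.measurableSet (half_pos hη)
  refine tendsto_of_tendsto_of_tendsto_of_le_of_le' tendsto_const_nhds hD
    (Eventually.of_forall fun _ => zero_le) ?_
  have hlarge : ∀ᶠ k : ℕ in atTop, (L : ℝ) / k < η / 2 :=
    (tendsto_const_div_atTop_nhds_zero_nat (L : ℝ)).eventually (gt_mem_nhds (half_pos hη))
  filter_upwards [hlarge, eventually_gt_atTop 0] with k hk hk0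
  refine le_trans (measure_mono fun x hx => ?_) (measure_iUnion_fintype_le _ fun a => D a k)
  by_contra hxD
  simp only [mem_iUnion, not_exists] at hxD
  refine hx ⟨window_mem_language x 0 hk0, hball (hdist _ _ fun l hl c => ?_)⟩
  have h1 := hxD ⟨⟨l, hl⟩, c⟩
  simp only [D, mem_ofPred_eq, not_le] at h1
  have h2 := abs_freq_window_sub_le x (C := ⟨l + 1, c⟩) l.succ_pos k
  have h3 : (((l + 1 : ℕ) : ℝ)) / k ≤ L / k :=
    div_le_div_of_nonneg_right (by exact_mod_cast hl) (Nat.cast_nonneg _)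
  refine (abs_sub_le _ _ _).trans_lt (lt_of_lt_of_eq
    (add_lt_add_of_le_of_lt (h2.trans (h3.trans hk.le)) h1) (add_halves η))

end BlockMeasureSpace

end ErgodicBlocks

/-! ### Uniformly rare bad coordinates -/

section UniformFrequency

open MeasureTheory Filter Topology Set

open Classical in
-- Two families serve the two-sided case, for blocks that start and blocks that end at a coordinate,
-- with a common `n` and `N`.
theorem exists_forall_card_orbit_mem_union_lt {Y : Type*} [TopologicalSpace Y] [MeasurableSpace Y]
    [BorelSpace Y] [HasOuterApproxClosed Y] [CompactSpace Y] [T2Space Y] {T : Y → Y}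
    (hT : Continuous T) {G G' : ℕ → Set Y} (hG : ∀ k, IsClosed (G k)) (hG' : ∀ k, IsClosed (G' k))
    (hGerg : ∀ μ : ProbabilityMeasure Y, Ergodic T (μ : Measure Y) →
      Tendsto (fun k => (μ : Measure Y) (G k)) atTop (𝓝 0))
    (hGerg' : ∀ μ : ProbabilityMeasure Y, Ergodic T (μ : Measure Y) →
      Tendsto (fun k => (μ : Measure Y) (G' k)) atTop (𝓝 0))
    (m : ℕ) {ε : ℝ} (hε : 0 < ε) :
    ∃ n N : ℕ, m ≤ n ∧ 0 < N ∧ ∀ y, (((Finset.range N).filter fun j =>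
      T^[j] y ∈ (⋂ k ∈ Icc m n, G k) ∪ ⋂ k ∈ Icc m n, G' k).card : ℝ) < ε * N := by
  have hanti : ∀ H : ℕ → Set Y, Antitone fun n => ⋂ k ∈ Icc m (m + n), H k := fun H a b hab =>
    biInter_subset_biInter_left (Icc_subset_Icc_right (by omega))
  have hlim : ∀ (μ : ProbabilityMeasure Y) (H : ℕ → Set Y),
      Tendsto (fun k => (μ : Measure Y) (H k)) atTop (𝓝 0) →
      Tendsto (fun n => (μ : Measure Y) (⋂ k ∈ Icc m (m + n), H k)) atTop (𝓝 0) := by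
    intro μ H hH
    have hshift : Tendsto (fun n => m + n) atTop atTop := tendsto_atTop_mono
      (fun n => Nat.le_add_left n m) tendsto_id
    exact tendsto_of_tendsto_of_tendsto_of_le_of_le tendsto_const_nhds (hH.comp hshift)
      (fun _ => zero_le) fun n => measure_mono (biInter_subset_of_mem ⟨Nat.le_add_right _ _, le_rfl⟩)
  obtain ⟨n, N, hN, h⟩ := exists_forall_card_orbit_lt hT
    (F := fun n => (⋂ k ∈ Icc m (m + n), G k) ∪ ⋂ k ∈ Icc m (m + n), G' k)
    (fun a b hab => union_subset_union (hanti G hab) (hanti G' hab))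
    (fun n => (isClosed_biInter fun k _ => hG k).union (isClosed_biInter fun k _ => hG' k))
    (fun μ hμ => tendsto_of_tendsto_of_tendsto_of_le_of_le tendsto_const_nhds
      (by simpa using (hlim μ G (hGerg μ hμ)).add (hlim μ G' (hGerg' μ hμ)))
      (fun _ => zero_le) fun n => measure_union_le _ _) hε
  refine ⟨m + n, N, Nat.le_add_right _ _, hN, fun y => ?_⟩
  convert h y

end UniformFrequency

/-! ### Greedy decomposition -/

section Greedy

/-- A greedy decomposition of `ℕ` into gaps and steps: a step `k ∈ [m, n]` from a position `i` is
taken as soon as `P i k` holds. -/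
theorem exists_greedy_steps {P : ℕ → ℕ → Prop} {m n : ℕ}
    (h : ∀ s, ∃ i ≥ s, ∃ k, m ≤ k ∧ k ≤ n ∧ P i k) :
    ∃ a b s : ℕ → ℕ, (∀ j, s j = ∑ i ∈ Finset.range j, (a i + b i)) ∧
      (∀ j, m ≤ b j ∧ b j ≤ n ∧ P (s j + a j) (b j)) ∧
      ∀ j t, s j ≤ t → t < s j + a j → ∀ k, m ≤ k → k ≤ n → ¬ P t k := by
  classical
  have hstep : ∀ s, ∃ a b, m ≤ b ∧ b ≤ n ∧ P (s + a) b ∧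
      ∀ t, s ≤ t → t < s + a → ∀ k, m ≤ k → k ≤ n → ¬ P t k := by
    intro s
    have hex : ∃ a, ∃ k, m ≤ k ∧ k ≤ n ∧ P (s + a) k := by
      obtain ⟨i, hi, hk⟩ := h s
      exact ⟨i - s, by rwa [Nat.add_sub_cancel' hi]⟩
    obtain ⟨b, hb⟩ := Nat.find_spec hex
    refine ⟨Nat.find hex, b, hb.1, hb.2.1, hb.2.2, fun t hst hta k hmk hkn hP => ?_⟩
    refine Nat.find_min hex (m := t - s) (by omega) ⟨k, hmk, hkn, ?_⟩
    rwa [Nat.add_sub_cancel' hst]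
  choose f g hfg using hstep
  let s : ℕ → ℕ := fun j => Nat.rec 0 (fun _ r => r + (f r + g r)) j
  refine ⟨fun j => f (s j), fun j => g (s j), s, fun j => ?_, fun j => ?_, fun j => ?_⟩
  · induction j with
    | zero => rfl
    | succ j ih => rw [Finset.sum_range_succ, ← ih]
  · exact ⟨(hfg _).1, (hfg _).2.1, (hfg _).2.2.1⟩
  · exact (hfg _).2.2.2

theorem exists_lt_totalLength {Λ : Type*} {A B : ℕ → Block Λ} (hB : ∀ j, 0 < (B j).length)
    (i : ℕ) : ∃ j, i < totalLength A B j := by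
  refine ⟨i + 1, ?_⟩
  rw [totalLength]
  calc i < ∑ _j ∈ Finset.range (i + 1), 1 := by simp
    _ ≤ _ := Finset.sum_le_sum fun j _ => by have := hB j; omega

theorem totalLength_window {Λ I : Type*} [AddMonoidWithOne I] (x : I → Λ) (u v : ℕ → I)
    (a b : ℕ → ℕ) (j : ℕ) :
    totalLength (fun j => window x (u j) (a j)) (fun j => window x (v j) (b j)) j =
      ∑ i ∈ Finset.range j, (a i + b i) := rfl

end Greedy

/-! ### Bounding the upper Banach density -/

section Density

open Classical in
-- The infimum over window lengths is at most its term at the single length `N`.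
theorem upperBanachDensity_le {I : Type*} [AddMonoidWithOne I] [Preorder I]
    (hI : ∀ (i : I) (N : ℕ), ∀ t ∈ Set.Ico i (i + (N : I)), ∃ j < N, i + (j : I) = t)
    {S M : Set I} (hSM : S ⊆ M) {c : ℝ} {N : ℕ} (hN : 0 < N)
    (h : ∀ i : I, (((Finset.range N).filter fun j => i + ((j : ℕ) : I) ∈ M).card : ℝ) ≤ c * N) :
    upperBanachDensity S ≤ c := by
  refine (ciInf_le ⟨0, ?_⟩ ⟨N, hN⟩).trans (ciSup_le fun i => ?_)
  · rintro _ ⟨N, rfl⟩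
    exact Real.iSup_nonneg fun i => by positivity
  · rw [div_le_iff₀ (by exact_mod_cast hN)]
    refine le_trans ?_ (h i)
    have hsub : S ∩ Set.Ico i (i + ((N : ℕ) : I)) ⊆
        ↑(((Finset.range N).filter fun j => i + ((j : ℕ) : I) ∈ M).image
          fun j : ℕ => i + (j : I)) := by
      rintro t ⟨htS, ht⟩
      obtain ⟨j, hj, rfl⟩ := hI i N t ht
      simp only [Finset.coe_image, Finset.coe_filter, Finset.mem_range]
      exact ⟨j, ⟨hj, hSM htS⟩, rfl⟩
    have h1 := (Set.ncard_le_ncard hsub (Finset.finite_toSet _)).trans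
      ((Set.ncard_coe_finset _).le.trans Finset.card_image_le)
    exact_mod_cast h1

end Density

/-! ### The two concatenation theorems -/

section Main

theorem BlockMeasureSpace.IsErgodicBlock.length_pos {Λ I : Type*} [TopologicalSpace Λ]
    [MeasurableSpace Λ] [AddMonoidWithOne I] {X : Subshift Λ I} {U : Set (BlockMeasureSpace X)}
    {B : Block Λ} (h : IsErgodicBlock U B) : 0 < B.length :=
  h.1.1

open MeasureTheory Filter Topology Set BlockMeasureSpace

variable {Λ : Type*} [Fintype Λ] [TopologicalSpace Λ] [DiscreteTopology Λ] [MeasurableSpace Λ]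
  [BorelSpace Λ]

/-- The window `[1 - k, 0]` ends at the coordinate `0`; `σ ^ (k - 1)` moves it to `[0, k)`, so
invariance of `μ` reduces the claim to the forward case. -/
theorem tendsto_measure_not_isErgodicBlock_backward {X : Subshift Λ ℤ}
    {U : Set (BlockMeasureSpace X)} (hUo : IsOpen U) (hU : ContainsErgodic U)
    {μ : ProbabilityMeasure X.carrier} (hμ : Ergodic (shiftOn X) (μ : Measure X.carrier)) :
    Tendsto (fun k : ℕ => (μ : Measure X.carrier)
      {x | ¬ IsErgodicBlock U (window (x : ℤ → Λ) (1 - (k : ℤ)) k)}) atTop (𝓝 0) := by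
  refine (hU.tendsto_measure_not_isErgodicBlock hUo hμ).congr' ?_
  filter_upwards [eventually_gt_atTop 0] with k hk
  obtain ⟨k, rfl⟩ := Nat.exists_eq_succ_of_ne_zero hk.ne'
  rw [← (hμ.toMeasurePreserving.iterate k).measure_preimage
    (isClopen_setOf_window (fun B => ¬ IsErgodicBlock U B) (1 - ((k + 1 : ℕ) : ℤ))
      (k + 1)).1.measurableSet.nullMeasurableSet]
  congr 1
  ext x
  simp [coe_iterate_shiftOn, window_shift]

open Classical in
theorem exists_concatenation (X : Subshift Λ ℕ) {U : Set (BlockMeasureSpace X)} (hUo : IsOpen U)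
    (hU : ContainsErgodic U) (m : ℕ) {ε : ℝ} (hε : 0 < ε) :
    ∃ n, m ≤ n ∧ ∀ x ∈ X.carrier, ∃ A B : ℕ → Block Λ, IsConcatenation x A B ∧
      (∀ j, IsErgodicBlock U (B j) ∧ m ≤ (B j).length ∧ (B j).length ≤ n) ∧
      upperBanachDensity (coveredCoords A B) < ε := by
  have : CompactSpace X.carrier := isCompact_iff_compactSpace.1 X.isClosed.isCompact
  set G : ℕ → Set X.carrier := fun k => {y | ¬ IsErgodicBlock U (window (y : ℕ → Λ) 0 k)}
  have hGc : ∀ k, IsClosed (G k) := fun k =>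
    (isClopen_setOf_window (fun B => ¬ IsErgodicBlock U B) _ _).1
  have hGerg : ∀ μ : ProbabilityMeasure X.carrier,
      Ergodic (shiftOn X) (μ : Measure X.carrier) →
      Tendsto (fun k => (μ : Measure X.carrier) (G k)) atTop (𝓝 0) := fun μ hμ =>
    hU.tendsto_measure_not_isErgodicBlock hUo hμ
  -- In the bound `min (ε / 2) 1`, `ε / 2` leaves room for a strict final inequality, and `1` forces
  -- a good coordinate in every window of length `N`, so that the greedy search terminates.
  obtain ⟨n, N, hmn, hN, h⟩ := exists_forall_card_orbit_mem_union_lt continuous_shiftOn hGc hGc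
    hGerg hGerg m (ε := min (ε / 2) 1) (by positivity)
  refine ⟨n, hmn, fun x hx => ?_⟩
  set M : Set ℕ := {t | ∀ k, m ≤ k → k ≤ n → ¬ IsErgodicBlock U (window x t k)}
  have hcard : ∀ i : ℕ, (((Finset.range N).filter fun j => i + j ∈ M).card : ℝ) <
      min (ε / 2) 1 * N := by
    intro i
    convert h ⟨shift i x, X.mapsTo i hx⟩ using 5 with j
    simp [M, G, coe_iterate_shiftOn, window_shift]
  have hinf : ∀ s, ∃ i ≥ s, ∃ k, m ≤ k ∧ k ≤ n ∧ IsErgodicBlock U (window x i k) := by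
    intro s
    by_contra! hcon
    have h1 := hcard s
    rw [Finset.filter_true_of_mem (p := fun j => s + j ∈ M)
      fun j _ => hcon (s + j) (Nat.le_add_right _ _), Finset.card_range] at h1
    have h2 : min (ε / 2) 1 * N ≤ 1 * (N : ℝ) := by gcongr; exact min_le_right _ _
    linarith
  obtain ⟨a, b, s, hs, hb, ha⟩ := exists_greedy_steps hinf
  refine ⟨fun j => window x (s j) (a j), fun j => window x (s j + a j) (b j),
    ⟨exists_lt_totalLength fun j => (hb j).2.2.length_pos, fun j => ?_⟩,
    fun j => ⟨(hb j).2.2, (hb j).1, (hb j).2.1⟩, ?_⟩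
  · rw [totalLength_window, ← hs]
    exact ⟨window_occursAt _ _ _, window_occursAt _ _ _⟩
  · refine (upperBanachDensity_le (M := M) (c := ε / 2) ?_ ?_ hN fun i => ?_).trans_lt
      (half_lt_self hε)
    · intro i N t ht
      exact ⟨t - i, by have := ht.1; have := ht.2; simp only [Nat.cast_id] at this; omega, Nat.add_sub_cancel' ht.1⟩
    · refine iUnion_subset fun j t ht => ?_
      rw [totalLength_window, ← hs] at ht
      exact ha j t ht.1 ht.2
    · refine le_of_eq_of_le ?_ ((hcard i).le.trans
        (mul_le_mul_of_nonneg_right (min_le_left _ _) (Nat.cast_nonneg _)))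
      congr!

open Classical in
theorem exists_biConcatenation (X : Subshift Λ ℤ) {U : Set (BlockMeasureSpace X)} (hUo : IsOpen U)
    (hU : ContainsErgodic U) (m : ℕ) {ε : ℝ} (hε : 0 < ε) :
    ∃ n, m ≤ n ∧ ∀ x ∈ X.carrier, ∃ A B A' B' : ℕ → Block Λ, IsBiConcatenation x A B A' B' ∧
      (∀ j, IsErgodicBlock U (B j) ∧ m ≤ (B j).length ∧ (B j).length ≤ n) ∧
      (∀ j, IsErgodicBlock U (B' j) ∧ m ≤ (B' j).length ∧ (B' j).length ≤ n) ∧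
      upperBanachDensity (biCoveredCoords A B A' B') < ε := by
  have : CompactSpace X.carrier := isCompact_iff_compactSpace.1 X.isClosed.isCompact
  set G : ℕ → Set X.carrier := fun k => {y | ¬ IsErgodicBlock U (window (y : ℤ → Λ) 0 k)}
  set G' : ℕ → Set X.carrier :=
    fun k => {y | ¬ IsErgodicBlock U (window (y : ℤ → Λ) (1 - (k : ℤ)) k)}
  obtain ⟨n, N, hmn, hN, h⟩ := exists_forall_card_orbit_mem_union_lt continuous_shiftOn
    (G := G) (G' := G')
    (fun k => (isClopen_setOf_window (fun B => ¬ IsErgodicBlock U B) _ _).1)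
    (fun k => (isClopen_setOf_window (fun B => ¬ IsErgodicBlock U B) _ _).1)
    (fun μ hμ => hU.tendsto_measure_not_isErgodicBlock hUo hμ)
    (fun μ hμ => tendsto_measure_not_isErgodicBlock_backward hUo hU hμ)
    m (ε := min (ε / 2) 1) (by positivity)
  refine ⟨n, hmn, fun x hx => ?_⟩
  -- The second alternative concerns `[t + 1 - k, t]`, the windows ending at `t`.
  set M : Set ℤ := {t | (∀ k : ℕ, m ≤ k → k ≤ n → ¬ IsErgodicBlock U (window x t k)) ∨
    ∀ k : ℕ, m ≤ k → k ≤ n → ¬ IsErgodicBlock U (window x (t + (1 - (k : ℤ))) k)}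
  have hcard : ∀ i : ℤ, (((Finset.range N).filter fun j : ℕ => i + (j : ℤ) ∈ M).card : ℝ) <
      min (ε / 2) 1 * N := by
    intro i
    convert h ⟨shift i x, X.mapsTo i hx⟩ using 5 with j
    simp [M, G, G', coe_iterate_shiftOn, window_shift, add_assoc]
  have hnotMem : ∀ i : ℤ, ∃ j < N, i + (j : ℤ) ∉ M := by
    intro i
    by_contra! hcon
    have h1 := hcard i
    rw [Finset.filter_true_of_mem fun j hj => hcon j (Finset.mem_range.1 hj),
      Finset.card_range] at h1
    have h2 : min (ε / 2) 1 * N ≤ 1 * (N : ℝ) := by gcongr; exact min_le_right _ _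
    linarith
  have hright : ∀ s : ℕ, ∃ i ≥ s, ∃ k, m ≤ k ∧ k ≤ n ∧
      IsErgodicBlock U (window x (i : ℤ) k) := by
    intro s
    obtain ⟨j, -, hj⟩ := hnotMem s
    simp only [M, mem_ofPred_eq, not_or] at hj
    have hj := hj.1
    push Not at hj
    exact ⟨s + j, Nat.le_add_right _ _, by exact_mod_cast hj⟩
  have hleft : ∀ s : ℕ, ∃ i ≥ s, ∃ k : ℕ, m ≤ k ∧ k ≤ n ∧
      IsErgodicBlock U (window x (-(i : ℤ) - k) k) := by
    intro s
    -- The search runs over `[-s - N, -s)`. Position `i ≥ 0` of the reflected half-line is the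
    -- coordinate `-i - 1`, so the good coordinate `-s - N + j` has position `s + N - j - 1`, which
    -- is at least `s` because `j < N`.
    obtain ⟨j, hjN, hj⟩ := hnotMem (-(s : ℤ) - N)
    simp only [M, mem_ofPred_eq, not_or] at hj
    have hj := hj.2
    push Not at hj
    obtain ⟨k, hmk, hkn, hk⟩ := hj
    refine ⟨s + N - j - 1, by omega, k, hmk, hkn, ?_⟩
    convert hk using 2
    omega
  obtain ⟨a, b, s, hs, hb, ha⟩ := exists_greedy_steps hright
  obtain ⟨a', b', s', hs', hb', ha'⟩ := exists_greedy_steps hleft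
  have hB' : ∀ j, IsErgodicBlock U (window x (-(s' j : ℤ) - a' j - b' j) (b' j)) := by
    intro j
    have := (hb' j).2.2
    rwa [Nat.cast_add, neg_add, ← sub_eq_add_neg] at this
  refine ⟨fun j => window x (s j : ℤ) (a j), fun j => window x ((s j : ℤ) + a j) (b j),
    fun j => window x (-(s' j : ℤ) - a' j) (a' j),
    fun j => window x (-(s' j : ℤ) - a' j - b' j) (b' j),
    ⟨exists_lt_totalLength fun j => (hb j).2.2.length_pos, fun j => ?_,
      exists_lt_totalLength fun j => (hB' j).length_pos, fun j => ?_⟩,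
    fun j => ⟨by exact_mod_cast (hb j).2.2, (hb j).1, (hb j).2.1⟩,
    fun j => ⟨hB' j, (hb' j).1, (hb' j).2.1⟩, ?_⟩
  · rw [totalLength_window, ← hs]
    exact ⟨window_occursAt _ _ _, window_occursAt _ _ _⟩
  · rw [totalLength_window, ← hs']
    exact ⟨window_occursAt _ _ _, window_occursAt _ _ _⟩
  · refine (upperBanachDensity_le (M := M) (c := ε / 2) ?_ ?_ hN fun i => ?_).trans_lt
      (half_lt_self hε)
    · intro i N t ht
      exact ⟨(t - i).toNat, by have := ht.1; have := ht.2; omega, by have := ht.1; omega⟩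
    · refine union_subset (iUnion_subset fun j t ht => Or.inl ?_)
        (iUnion_subset fun j t ht => Or.inr ?_)
      · rw [totalLength_window, ← hs] at ht
        obtain ⟨h1, h2⟩ := ht
        lift t to ℕ using by omega
        exact ha j t (by omega) (by simp only [window_length] at h2; omega)
      · rw [totalLength_window, ← hs'] at ht
        obtain ⟨h1, h2⟩ := ht
        simp only [window_length] at h1
        intro k hmk hkn hk
        refine ha' j (-t - 1).toNat (by omega) (by omega) k hmk hkn ?_
        convert hk using 2
        omega
    · refine le_of_eq_of_le ?_ ((hcard i).le.trans
        (mul_le_mul_of_nonneg_right (min_le_left _ _) (Nat.cast_nonneg _)))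
      congr!

end Main

theorem theorem2p3 {Λ : Type*} [Fintype Λ] [TopologicalSpace Λ] [DiscreteTopology Λ]
    [MeasurableSpace Λ] [BorelSpace Λ] :
    -- two-sided subshifts
    (∀ (X : Subshift Λ ℤ) (U : Set (BlockMeasureSpace X)),
      IsOpen U → BlockMeasureSpace.ContainsErgodic U →
      ∀ (m : ℕ) (ε : ℝ), 0 < ε → ∃ n, m ≤ n ∧ ∀ x ∈ X.carrier,
        ∃ A B A' B' : ℕ → Block Λ,
          IsBiConcatenation x A B A' B' ∧
          (∀ j, BlockMeasureSpace.IsErgodicBlock U (B j) ∧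
            m ≤ (B j).length ∧ (B j).length ≤ n) ∧
          (∀ j, BlockMeasureSpace.IsErgodicBlock U (B' j) ∧
            m ≤ (B' j).length ∧ (B' j).length ≤ n) ∧
          upperBanachDensity (biCoveredCoords A B A' B') < ε) ∧
    -- one-sided subshifts
    (∀ (X : Subshift Λ ℕ) (U : Set (BlockMeasureSpace X)),
      IsOpen U → BlockMeasureSpace.ContainsErgodic U →
      ∀ (m : ℕ) (ε : ℝ), 0 < ε → ∃ n, m ≤ n ∧ ∀ x ∈ X.carrier,
        ∃ A B : ℕ → Block Λ,
          IsConcatenation x A B ∧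
          (∀ j, BlockMeasureSpace.IsErgodicBlock U (B j) ∧
            m ≤ (B j).length ∧ (B j).length ≤ n) ∧
          upperBanachDensity (coveredCoords A B) < ε) :=
  ⟨fun X _ hUo hU m _ hε => exists_biConcatenation X hUo hU m hε,
    fun X _ hUo hU m _ hε => exists_concatenation X hUo hU m hε⟩
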